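/- Let $q$ be a power of a prime $p$, let $A=\mathbb F_q[t]$, let $K$ be a finite field extension of $\mathbb F_q(t)$, and let $\overline K$ be an algebraic closure of $K$. Let $K\{\tau\}$ be the ring of polynomials in the Frobenius $\tau\colon x\mapsto x^q$ with coefficients in $K$, with the usual addition and with composition (so $\tau c=c^q\tau$) as multiplication; $f=\sum_n c_n\tau^n$ acts on $\overline K$ by $f(x)=\sum_n c_nx^{q^n}$. A Drinfeld module is a ring homomorphism $\phi\colon A\to K\{\tau\}$, $a\mapsto\phi_a$, such that the coefficient of $\tau^0$ in $\phi_a$ is $a$ for every $a\in A$, and $\phi_a\neq a\tau^0$ for some $a\in A$. Let $g$ be a positive integer, let $\phi_1,\dots,\phi_g\colon A\to K\{\tau\}$ be Drinfeld modules, and let $A$ act on $\mathbb G_a^g(\overline K)=\overline K^{\,g}$ by $\phi_a(x_1,\dots,x_g)=((\phi_1)_a(x_1),\dots,(\phi_g)_a(x_g))$. A $\phi$-submodule is a subgroup of $\overline K^{\,g}$ that is stable under this action; it is cyclic if it equals $\{\phi_a(x): a\in A\}$ for some $x\in\overline K^{\,g}$. **Theorem.** Let $\Gamma\subset\overline K^{\,g}$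 be an infinite cyclic $\phi$-submodule. Then there exists an infinite $\phi$-submodule $\Gamma_0\subset\Gamma$ such that for every Zariski closed affine subvariety $V\subset\mathbb G_a^g$ defined over $\overline K$ (the zero locus of an ideal of $\overline K[X_1,\dots,X_g]$, not necessarily irreducible), if $V(\overline K)\cap\Gamma$ is infinite, then $V(\overline K)\cap\Gamma$ contains a coset $y+\Gamma_0$ of $\Gamma_0$. -/

import Mathlib

open Polynomial
open scoped RatFunc Pointwise

noncomputable section

namespace DrinfeldML

section Field

variable (F K : Type*) [Field F] [Fintype F] [Field K] [Algebra F⟮X⟯ K]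

/-- The Frobenius `x ↦ x ^ q` of `K`, where `F` is the field with `q` elements and `K` is an
extension of the rational function field `F(t)`. -/
def frob : K →+* K :=
  letI : Algebra F K := ((algebraMap F⟮X⟯ K).comp (algebraMap F F⟮X⟯)).toAlgebra
  (FiniteField.frobeniusAlgHom F K).toRingHom

theorem frob_apply (x : K) : frob F K x = x ^ Fintype.card F := rfl

/-- The action of the free monoid on one generator `τ` on `K`, where `τ` acts by `x ↦ x ^ q`. -/
abbrev frobAction : MulSemiringAction (Multiplicative ℕ) K :=
  MulSemiringAction.compHom K (powersHom (K →+* K) (frob F K))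

/-- The ring `K{τ}` of polynomials in `τ` with coefficients in `K`, with `τ c = c ^ q τ`:
Mathlib's skew polynomials for the Frobenius `x ↦ x ^ q`. -/
def TwistedPoly : Type _ :=
  let _ := F
  SkewPolynomial K

namespace TwistedPoly

instance : Ring (TwistedPoly F K) :=
  letI := frobAction F K
  inferInstanceAs (Ring (SkewPolynomial K))

variable {F K}

/-- The coefficient of `τ ^ n`. -/
def coeff (f : TwistedPoly F K) (n : ℕ) : K :=
  SkewPolynomial.coeff (R := K) f n

variable (F) in
/-- The constant polynomial `c τ ^ 0`. -/
def const (c : K) : TwistedPoly F K :=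
  SkewPolynomial.C (R := K) c

/-- The value `∑ c_n x ^ (q ^ n)` of `∑ c_n τ ^ n` at a point `x` of an extension of `K`. -/
def eval {L : Type*} [Field L] [Algebra K L] (f : TwistedPoly F K) (x : L) : L :=
  SkewPolynomial.sum (R := K) f fun n c => algebraMap K L c * x ^ (Fintype.card F ^ n)

end TwistedPoly

/-- A Drinfeld module (of generic characteristic) over `K`: a ring homomorphism
`φ : F[t] → K{τ}` such that the coefficient of `τ ^ 0` in `φ_a` is `a` for all `a`, and
`φ_a ≠ a τ ^ 0` for some `a`. -/
structure DrinfeldModule where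
  toRingHom : F[X] →+* TwistedPoly F K
  coeff_zero : ∀ a : F[X],
    (toRingHom a).coeff 0 = algebraMap F⟮X⟯ K (algebraMap F[X] F⟮X⟯ a)
  exists_ne : ∃ a : F[X],
    toRingHom a ≠ TwistedPoly.const F (algebraMap F⟮X⟯ K (algebraMap F[X] F⟮X⟯ a))

end Field

section Action

variable {F K : Type*} [Field F] [Fintype F] [Field K] [Algebra F⟮X⟯ K]
variable {L : Type*} [Field L] [Algebra K L] {g : ℕ}

/-- The coordinatewise action of `a ∈ F[t]` on `L ^ g` given by `(φ_1, …, φ_g)`: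
`a * (x_1, …, x_g) = ((φ_1)_a(x_1), …, (φ_g)_a(x_g))`. -/
def act (φ : Fin g → DrinfeldModule F K) (a : F[X]) (x : Fin g → L) : Fin g → L :=
  fun i => ((φ i).toRingHom a).eval (x i)

/-- A `φ`-submodule is a subgroup that is stable under the action of `F[t]` through `φ`. -/
def IsSubmodule (φ : Fin g → DrinfeldModule F K) (Γ : AddSubgroup (Fin g → L)) : Prop :=
  ∀ a : F[X], ∀ x ∈ Γ, act φ a x ∈ Γ

/-- A `φ`-submodule is cyclic if it consists of the multiples `φ_a(x)` of a single point `x`. -/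
def IsCyclic (φ : Fin g → DrinfeldModule F K) (Γ : AddSubgroup (Fin g → L)) : Prop :=
  ∃ x : Fin g → L, (Γ : Set (Fin g → L)) = Set.range fun a : F[X] => act φ a x

end Action

end DrinfeldML

end

/-!
The proof is a non-archimedean Skolem argument that needs no completion.

Let `x` generate `Γ` and let `R ⊆ L` be the `F[t]`-algebra generated by the coordinates of `x` and
by the coefficients of the `φ_i`; it is finitely generated, because those of `φ_c` for constants `c`
and of `φ_t` suffice (`DrinfeldModule.coeff_mem`). A maximal ideal `M` of `R` has finite residue
field, so it meets `F[t]` in `(s)` with `s` prime, and some valuation ring `O` of `L` dominates `R`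
at `M` (`exists_valuationSubring_adjoin`). As `L` is algebraic over `F(t)`, the
valuation has rank one in the following sense: every nonzero element of `O` divides a power of `s`
(`exists_dvd_algebraMap_pow`), and `s` divides a power of every nonunit
(`exists_algebraMap_dvd_pow`). Hence `R` has finite image modulo `s ^ 2`, and some `b ≠ 0` sends `x`
to a point `w = φ_b(x)` with coordinates divisible by `s ^ 2`. Then `Γ₀ = {φ_a(w)}` works.

On `w` the action is analytic: comparing coefficients in `φ_a φ_s = φ_s φ_a` shows that the `n`-th
coefficient of `φ_a` is a polynomial in `a`, with denominator at most `s ^ (q ^ n - 1)` up to units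
of `O` (`exists_eval_eq_pow_mul_coeff`), so that `φ_a(w)` is the value at `a` of an `s`-adically convergent
series of polynomials over `O` (`DrinfeldModule.exists_expansion`). For a polynomial `f` vanishing
on `V`, which may be scaled to have coefficients in `O`, the function `a ↦ f(y + φ_a(w))` is then of
the same kind, and such a function with infinitely many zeros is zero
(`pow_dvd_of_infinite_zeros`, `eval_add_eq_zero_of_infinite`). Since `Γ` is a finite union of cosets
of `Γ₀`, one of them meets `V` in infinitely many points as soon as `Γ` does, and this coset lies
in `V`.
-/

/-! ### Composition of twisted polynomials -/

namespace SkewPolynomial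

variable {K L : Type*} [Field K] [Field L] [Algebra K L] {q : ℕ}

/-- The product rule for coefficients when `X ^ n` acts on the coefficients as `c ↦ c ^ (q ^ n)`. -/
theorem coeff_mul_of_smul_eq [MulSemiringAction (Multiplicative ℕ) K]
    (hq : ∀ (n : ℕ) (c : K), Multiplicative.ofAdd n • c = c ^ q ^ n)
    (f h : SkewPolynomial K) (n : ℕ) :
    (f * h).coeff n = ∑ i ∈ Finset.range (n + 1), f.coeff i * h.coeff (n - i) ^ q ^ i := by
  classical
  let u : ℕ → Multiplicative ℕ × Multiplicative ℕ := fun i =>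
    (Multiplicative.ofAdd i, Multiplicative.ofAdd (n - i))
  have hu : Function.Injective u := fun i j hij => congrArg (fun p => p.1.toAdd) hij
  refine (SkewMonoidAlgebra.coeff_mul_antidiagonal_of_finset f h
    (Multiplicative.ofAdd n) ((Finset.range (n + 1)).image u) fun {p} => ?_).trans ?_
  · rw [Finset.mem_image]
    constructor
    · rintro ⟨i, hi, rfl⟩
      rw [Finset.mem_range] at hi
      rw [← ofAdd_add]
      congr 1
      omega
    · intro hp
      have hp' : p.1.toAdd + p.2.toAdd = n := congrArg Multiplicative.toAdd hp
      refine ⟨p.1.toAdd, Finset.mem_range.mpr (by omega), Prod.ext rfl ?_⟩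
      change Multiplicative.ofAdd (n - p.1.toAdd) = p.2
      rw [← hp', Nat.add_sub_cancel_left]
      rfl
  · rw [Finset.sum_image hu.injOn]
    refine Finset.sum_congr rfl fun i _ => ?_
    rw [hq]
    rfl

theorem sum_eq_sum_range {S : Type*} [AddCommMonoid S] (f : SkewPolynomial K) {u : ℕ → K → S}
    (hu : ∀ n, u n 0 = 0) {N : ℕ} (hN : ∀ n, N ≤ n → f.coeff n = 0) :
    f.sum u = ∑ n ∈ Finset.range N, u n (f.coeff n) := by
  refine (sum_def f _).trans (Finset.sum_subset ?_ ?_)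
  · intro n hn
    rw [Finset.mem_range]
    by_contra h
    exact mem_support_iff.mp hn (hN n (not_lt.mp h))
  · intro n _ hn
    rw [notMem_support_iff.mp hn, hu]

/-- The evaluation `∑ c_n X ^ n ↦ ∑ c_n x ^ (q ^ n)` takes products to compositions when `X ^ n`
acts as `c ↦ c ^ (q ^ n)` and `q ^ n`-th powers are additive on the values. -/
theorem sum_mul_of_smul_eq [MulSemiringAction (Multiplicative ℕ) K]
    (hq : ∀ (n : ℕ) (c : K), Multiplicative.ofAdd n • c = c ^ q ^ n)
    (hL : ∀ (s : Finset (Multiplicative ℕ)) (u : Multiplicative ℕ → L) (n : ℕ),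
      (∑ i ∈ s, u i) ^ q ^ n = ∑ i ∈ s, u i ^ q ^ n)
    (f h : SkewPolynomial K) (x : L) :
    (f * h).sum (fun n c => algebraMap K L c * x ^ q ^ n) =
      f.sum fun n c => algebraMap K L c *
        (h.sum fun n c => algebraMap K L c * x ^ q ^ n) ^ q ^ n := by
  rw [SkewMonoidAlgebra.mul_def]
  simp only [sum_def']
  rw [SkewMonoidAlgebra.sum_sum_index (by simp) (by simp [add_mul])]
  refine SkewMonoidAlgebra.sum_congr fun a _ => ?_
  rw [SkewMonoidAlgebra.sum_sum_index (by simp) (by simp [add_mul]), 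
    SkewMonoidAlgebra.sum_def' h, SkewMonoidAlgebra.sum_def' h, hL, Finset.mul_sum]
  refine Finset.sum_congr rfl fun j _ => ?_
  rw [SkewMonoidAlgebra.sum_single_index (by simp)]
  have := hq a.toAdd
  simp only [ofAdd_toAdd] at this
  rw [this, toAdd_mul, map_mul, map_pow, mul_pow, ← pow_mul, ← pow_add,
    add_comm (Multiplicative.toAdd a), mul_assoc]

end SkewPolynomial

namespace DrinfeldML.TwistedPoly

variable {F K : Type*} [Field F] [Fintype F] [Field K] [Algebra F⟮X⟯ K]

theorem frobAction_ofAdd_smul (n : ℕ) (c : K) :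
    (frobAction F K).smul (Multiplicative.ofAdd n) c = c ^ Fintype.card F ^ n := by
  change (powersHom (K →+* K) (frob F K) (Multiplicative.ofAdd n)) c = _
  rw [powersHom_apply, toAdd_ofAdd]
  induction n with
  | zero => simp
  | succ n ih =>
    rw [pow_succ', RingHom.mul_def, RingHom.comp_apply, ih, frob_apply, pow_succ, pow_mul]

theorem coeff_add (f h : TwistedPoly F K) (n : ℕ) :
    (f + h).coeff n = f.coeff n + h.coeff n :=
  congrFun (congrArg DFunLike.coe
    (SkewMonoidAlgebra.coeff_add (k := K) (G := Multiplicative ℕ) f h))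
    (Multiplicative.ofAdd n)

theorem coeff_mul (f h : TwistedPoly F K) (n : ℕ) :
    (f * h).coeff n = ∑ i ∈ Finset.range (n + 1),
      f.coeff i * h.coeff (n - i) ^ Fintype.card F ^ i :=
  let := frobAction F K
  SkewPolynomial.coeff_mul_of_smul_eq (frobAction_ofAdd_smul (F := F)) f h n

variable {L : Type*} [Field L] [Algebra K L]

omit [Field F] [Fintype F] [Algebra F⟮X⟯ K] in
theorem coeff_eq_zero_of_large (f : TwistedPoly F K) :
    ∃ N, ∀ n, N ≤ n → f.coeff n = 0 := by
  obtain ⟨N, hN⟩ := (SkewPolynomial.support (R := K) f).bddAbove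
  refine ⟨N + 1, fun n hn => SkewPolynomial.notMem_support_iff.mp fun h => ?_⟩
  have := hN h
  omega

omit [Field F] [Algebra F⟮X⟯ K] in
theorem eval_eq_sum_range (f : TwistedPoly F K) {N : ℕ} (hN : ∀ n, N ≤ n → f.coeff n = 0) (x : L) :
    f.eval x = ∑ n ∈ Finset.range N, algebraMap K L (f.coeff n) * x ^ Fintype.card F ^ n :=
  SkewPolynomial.sum_eq_sum_range (K := K) f (by simp) hN

theorem eval_add (f h : TwistedPoly F K) (x : L) : (f + h).eval x = f.eval x + h.eval x := by
  refine SkewMonoidAlgebra.sum_add_index' (k := K) (G := Multiplicative ℕ) (f := f) (g := h)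
    (h := fun n c => algebraMap K L c * x ^ Fintype.card F ^ n.toAdd) ?_ ?_
  · simp
  · intros; simp [add_mul]

theorem pow_card_pow_sum [Algebra F L] {ι : Type*} (s : Finset ι) (u : ι → L) (n : ℕ) :
    (∑ i ∈ s, u i) ^ Fintype.card F ^ n = ∑ i ∈ s, u i ^ Fintype.card F ^ n := by
  have h (y : L) : ((FiniteField.frobeniusAlgHom F L).toRingHom ^ n) y
      = y ^ Fintype.card F ^ n := by
    induction n with
    | zero => simp
    | succ n ih =>
      rw [pow_succ', RingHom.mul_def, RingHom.comp_apply, ih, pow_succ, pow_mul]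
      rfl
  simp only [← h, map_sum]

theorem eval_mul (f h : TwistedPoly F K) (x : L) : (f * h).eval x = f.eval (h.eval x) :=
  let : Algebra F L := ((algebraMap K L).comp
    ((algebraMap F⟮X⟯ K).comp (algebraMap F F⟮X⟯))).toAlgebra
  let := frobAction F K
  SkewPolynomial.sum_mul_of_smul_eq (frobAction_ofAdd_smul (F := F))
    (pow_card_pow_sum (F := F)) f h x

end DrinfeldML.TwistedPoly

/-! ### Coefficients of the `φ_a` as polynomials in `a` -/

/-- If a sequence `α` commutes with `c` under twisted convolution (as the coefficients of `φ_a` and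
`φ_s` do), then the `n`-th equation reads
`c₀ (1 - c₀ ^ (q ^ n - 1)) α_n = ∑_{j < n} (α_j c_{n-j} ^ (q ^ j) - c_{n-j} α_j ^ (q ^ (n-j)))`. So
`α_n` is the value at `α₀` of a polynomial that does not depend on `α`, with a power of `c₀` as
denominator. -/
theorem exists_eval_eq_pow_mul_coeff {O : Type*} [CommRing O] {q : ℕ} (hq : 2 ≤ q) (c : ℕ → O)
    (hu : ∀ m, m ≠ 0 → IsUnit (1 - c 0 ^ m)) (n : ℕ) :
    ∃ P : O[X], ∀ α : ℕ → O,
      (∀ m, ∑ i ∈ Finset.range (m + 1), α i * c (m - i) ^ q ^ i =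
        ∑ i ∈ Finset.range (m + 1), c i * α (m - i) ^ q ^ i) →
      c 0 ^ (q ^ n - 1) * α n = P.eval (α 0) := by
  induction n using Nat.strong_induction_on with
  | _ n ih =>
  choose! P hP using ih
  rcases n with _ | n
  · exact ⟨X, fun α _ => by simp⟩
  have hpos (m : ℕ) : 0 < q ^ m := pow_pos (by omega) m
  have h2 : 2 ≤ q ^ (n + 1) := hq.trans (Nat.le_self_pow (by omega) q)
  obtain ⟨u, hu'⟩ := hu (q ^ (n + 1) - 1) (by omega)
  refine ⟨C (↑u⁻¹ : O) * (∑ j ∈ Finset.range (n + 1),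
    (C (c (n + 1 - j) ^ q ^ j * c 0 ^ (q ^ (n + 1) - 2 - (q ^ j - 1))) * P j
      - C (c (n + 1 - j) * c 0 ^ (q ^ (n + 1) - 2 - (q ^ j - 1) * q ^ (n + 1 - j)))
        * P j ^ q ^ (n + 1 - j))), fun α hα => ?_⟩
  have key : c 0 * (1 - c 0 ^ (q ^ (n + 1) - 1)) * α (n + 1) =
      ∑ j ∈ Finset.range (n + 1),
        (α j * c (n + 1 - j) ^ q ^ j - c (n + 1 - j) * α j ^ q ^ (n + 1 - j)) := by
    have h := hα (n + 1)
    rw [Finset.sum_range_succ, Nat.sub_self,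
      ← Finset.sum_range_reflect (fun i => c i * α (n + 1 - i) ^ q ^ i),
      Finset.sum_range_succ _ (n + 1)] at h
    simp only [Nat.add_sub_cancel, Nat.sub_self, pow_zero, pow_one, Nat.sub_zero] at h
    have hr : ∑ i ∈ Finset.range (n + 1), c (n + 1 - i) * α (n + 1 - (n + 1 - i)) ^ q ^ (n + 1 - i)
        = ∑ i ∈ Finset.range (n + 1), c (n + 1 - i) * α i ^ q ^ (n + 1 - i) :=
      Finset.sum_congr rfl fun i hi => by
        rw [Nat.sub_sub_self (Finset.mem_range.mp hi).le]
    rw [hr] at h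
    rw [Finset.sum_sub_distrib, mul_sub, ← pow_succ',
      Nat.sub_add_cancel (hpos (n + 1))]
    linear_combination -h
  -- By induction `c₀ ^ (q ^ (n + 1) - 2)` clears the denominators of both terms, as
  -- `(q ^ j - 1) q ^ (n + 1 - j) = q ^ (n + 1) - q ^ (n + 1 - j) ≤ q ^ (n + 1) - 2`.
  have hterm : ∀ j ∈ Finset.range (n + 1),
      c 0 ^ (q ^ (n + 1) - 2) *
        (α j * c (n + 1 - j) ^ q ^ j - c (n + 1 - j) * α j ^ q ^ (n + 1 - j)) =
      (C (c (n + 1 - j) ^ q ^ j * c 0 ^ (q ^ (n + 1) - 2 - (q ^ j - 1))) * P j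
      - C (c (n + 1 - j) * c 0 ^ (q ^ (n + 1) - 2 - (q ^ j - 1) * q ^ (n + 1 - j)))
        * P j ^ q ^ (n + 1 - j)).eval (α 0) := by
    intro j hj
    rw [Finset.mem_range] at hj
    have hj' : q ^ j * q ^ (n + 1 - j) = q ^ (n + 1) := by
      rw [← pow_add]; congr 1; omega
    have h2' : 2 ≤ q ^ (n + 1 - j) := hq.trans (Nat.le_self_pow (by omega) q)
    have e1 : (q ^ j - 1) * q ^ (n + 1 - j) = q ^ (n + 1) - q ^ (n + 1 - j) := by
      rw [Nat.sub_mul, hj', one_mul]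
    have l1 : (q ^ j - 1) * q ^ (n + 1 - j) ≤ q ^ (n + 1) - 2 := by omega
    have l2 : q ^ j - 1 ≤ q ^ (n + 1) - 2 :=
      (Nat.le_mul_of_pos_right _ (hpos _)).trans l1
    simp only [eval_sub, eval_mul, eval_C, eval_pow, ← hP j hj α hα, mul_pow, ← pow_mul]
    rw [mul_sub]
    congr 1
    · rw [mul_assoc, ← mul_assoc (c 0 ^ _) (c 0 ^ _), ← pow_add, Nat.sub_add_cancel l2]; ring
    · rw [mul_assoc, ← mul_assoc (c 0 ^ _) (c 0 ^ _), ← pow_add, Nat.sub_add_cancel l1]; ring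
  rw [eval_mul, eval_C, eval_finsetSum, ← Finset.sum_congr rfl hterm, ← Finset.mul_sum, ← key,
    ← hu', show q ^ (n + 1) - 1 = q ^ (n + 1) - 2 + 1 by omega, pow_succ]
  linear_combination (-c 0 ^ (q ^ (n + 1) - 2) * c 0 * α (n + 1)) * u.inv_mul

/-! ### Power series with infinitely many zeros -/

/-- Cramer's rule for interpolation: a common divisor of the values of a polynomial of degree `< n`
at `n` points divides its coefficients up to the Vandermonde determinant. -/
theorem dvd_det_vandermonde_mul_coeff {O : Type*} [CommRing O] {n : ℕ} (z : Fin n → O)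
    {r : O[X]} (hr : r.degree < n) {a : O} (h : ∀ i, a ∣ r.eval (z i)) (j : ℕ) :
    a ∣ (Matrix.vandermonde z).det * r.coeff j := by
  by_cases hj : j < n
  · have e : Matrix.mulVec (Matrix.vandermonde z) (fun k : Fin n => r.coeff k) =
        fun i => r.eval (z i) := by
      funext i
      rcases Nat.eq_zero_or_pos n with rfl | hn
      · exact i.elim0
      have hr' : r.natDegree < n := by
        rcases eq_or_ne r 0 with rfl | h0
        · simpa using hn
        · exact (natDegree_lt_iff_degree_lt h0).mpr hr
      rw [eval_eq_sum_range' hr',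
        ← Fin.sum_univ_eq_sum_range (fun k => r.coeff k * z i ^ k), Matrix.mulVec_eq_sum]
      simp only [Finset.sum_apply, Pi.smul_apply, Matrix.vandermonde_apply, Matrix.transpose_apply,
        op_smul_eq_mul, mul_comm]
    have := congrFun (congrArg (Matrix.mulVec (Matrix.vandermonde z).adjugate) e) ⟨j, hj⟩
    rw [Matrix.mulVec_mulVec, Matrix.adjugate_mul, Matrix.smul_mulVec, Matrix.one_mulVec] at this
    simp only [Pi.smul_apply, smul_eq_mul] at this
    rw [this, Matrix.mulVec_eq_sum, Finset.sum_apply]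
    exact Finset.dvd_sum fun i _ => by
      rw [Pi.smul_apply, op_smul_eq_mul]
      exact (h i).mul_left _
  · rw [coeff_eq_zero_of_degree_lt (hr.trans_le (by exact_mod_cast not_lt.mp hj)), mul_zero]
    exact dvd_zero _

/-- A form of Strassmann's theorem for the `s`-adic limit of the polynomials `G k`: if the limit has
infinitely many zeros in `O`, it is zero. If `n` exceeds the degree of `G k` and `Q` is a monic
polynomial with `n` of the zeros as roots, then `G k ≡ G m` modulo `s ^ k` remains true after
reducing both sides modulo `Q`, which does not change `G k`; and the remainder of `G m` is small for
large `m` because it is determined by its values at these zeros. -/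
theorem pow_dvd_of_infinite_zeros {O : Type*} [CommRing O] [IsDomain O] {s : O} (hs : s ≠ 0)
    (hdiv : ∀ d : O, d ≠ 0 → ∃ j, d ∣ s ^ j) {G : ℕ → O[X]}
    (hG : ∀ k, C (s ^ k) ∣ G (k + 1) - G k)
    (hinf : {z : O | ∀ k, s ^ k ∣ (G k).eval z}.Infinite) (k : ℕ) : C (s ^ k) ∣ G k := by
  have hG' : ∀ m, C (s ^ k) ∣ G (k + m) - G k := by
    intro m
    induction m with
    | zero => simp
    | succ m ih =>
      rw [← sub_add_sub_cancel (G (k + (m + 1))) (G (k + m))]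
      exact dvd_add (((map_dvd C (pow_dvd_pow s (Nat.le_add_right k m))).trans (hG _))) ih
  set n := (G k).natDegree + 1 with hn
  have : Infinite {z : O | ∀ k, s ^ k ∣ (G k).eval z} := hinf.to_subtype
  let e := (Infinite.natEmbedding {z : O | ∀ k, s ^ k ∣ (G k).eval z})
  let z : Fin n → O := fun i => e i
  have hz : Function.Injective z := fun i j h => Fin.ext (e.injective (Subtype.ext h))
  obtain ⟨j, hj⟩ := hdiv _ (Matrix.det_vandermonde_ne_zero_iff.mpr hz)
  let Q : O[X] := ∏ i, (X - C (z i))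
  have hQ : Q.Monic := monic_prod_of_monic _ _ fun i _ => monic_X_sub_C _
  have hQd : Q.degree = n := by
    simp [Q, degree_prod]
  have hself : G k %ₘ Q = G k := by
    rw [modByMonic_eq_self_iff hQ, hQd]
    exact degree_le_natDegree.trans_lt (by rw [hn]; exact_mod_cast Nat.lt_succ_self _)
  obtain ⟨H, hH⟩ := hG' j
  have hr : G (k + j) %ₘ Q = G k + C (s ^ k) * (H %ₘ Q) := by
    rw [← sub_add_cancel (G (k + j)) (G k), hH, add_modByMonic, hself, add_comm, ← smul_eq_C_mul,
      smul_modByMonic, smul_eq_C_mul]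
  -- The zeros chosen are roots of `Q`, so the remainder has the same small values there.
  have hrz : ∀ i, s ^ (k + j) ∣ (G (k + j) %ₘ Q).eval (z i) := by
    intro i
    have h0 : Q.eval (z i) = 0 := by
      simp only [Q, eval_prod, eval_sub, eval_X, eval_C]
      exact Finset.prod_eq_zero (Finset.mem_univ i) (sub_self _)
    rw [modByMonic_eq_sub_mul_div, eval_sub, eval_mul, h0, zero_mul, sub_zero]
    exact (e i).2 _
  have hdvd : C (s ^ k) ∣ G (k + j) %ₘ Q := by
    rw [C_dvd_iff_dvd_coeff]
    intro i
    have h1 := dvd_det_vandermonde_mul_coeff z (hQd ▸ degree_modByMonic_lt _ hQ) hrz i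
    have h2 : s ^ (k + j) ∣ s ^ j * (G (k + j) %ₘ Q).coeff i := h1.trans (mul_dvd_mul_right hj _)
    rw [add_comm k j, pow_add, add_comm j k] at h2
    exact (mul_dvd_mul_iff_left (pow_ne_zero j hs)).mp h2
  rw [hr] at hdvd
  exact (dvd_add_left (dvd_mul_right _ _)).mp hdvd

theorem MvPolynomial.dvd_aeval_sub_aeval {R S σ : Type*} [CommRing R] [CommRing S] [Algebra R S]
    {d : S} {u v : σ → S} (h : ∀ i, d ∣ u i - v i) (f : MvPolynomial σ R) :
    d ∣ aeval u f - aeval v f := by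
  rw [← Ideal.Quotient.eq_zero_iff_dvd, map_sub, sub_eq_zero]
  have e (w : σ → S) : Ideal.Quotient.mk (Ideal.span {d}) (aeval w f) =
      aeval (fun i => Ideal.Quotient.mk (Ideal.span {d}) (w i)) f := by
    exact (comp_aeval_apply w (Ideal.Quotient.mkₐ R (Ideal.span {d})) f)
  rw [e, e]
  congr 2
  funext i
  rw [← sub_eq_zero, ← map_sub, Ideal.Quotient.eq_zero_iff_dvd]
  exact h i

/-- If `e a` is the `s`-adic limit of the series `∑ S n` at `z a`, then a polynomial that vanishes
at `y + e a` for infinitely many `a` does so for all `a`. -/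
theorem eval_add_eq_zero_of_infinite {O A σ : Type*} [CommRing O] [IsDomain O] {s : O} (hs : s ≠ 0)
    (hu : ¬ IsUnit s) (hdiv : ∀ d : O, d ≠ 0 → ∃ j, d ∣ s ^ j) {z : A → O}
    (hz : Function.Injective z) {e : A → σ → O} {S : σ → ℕ → O[X]}
    (hS : ∀ i n, C (s ^ n) ∣ S i n)
    (he : ∀ a i k, s ^ k ∣ e a i - ∑ n ∈ Finset.range k, (S i n).eval (z a))
    (y : σ → O) (f : MvPolynomial σ O)
    (hinf : {a | MvPolynomial.eval (y + e a) f = 0}.Infinite) (a : A) :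
    MvPolynomial.eval (y + e a) f = 0 := by
  let G : ℕ → O[X] := fun k =>
    MvPolynomial.aeval (fun i => C (y i) + ∑ n ∈ Finset.range k, S i n) f
  have hG : ∀ k, C (s ^ k) ∣ G (k + 1) - G k := fun k =>
    MvPolynomial.dvd_aeval_sub_aeval (fun i => by
      rw [Finset.sum_range_succ]; convert hS i k using 1; ring) f
  have hGe : ∀ k a, s ^ k ∣ MvPolynomial.eval (y + e a) f - (G k).eval (z a) := by
    intro k a
    have : (G k).eval (z a) = MvPolynomial.aeval
        (fun i => y i + ∑ n ∈ Finset.range k, (S i n).eval (z a)) f := by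
      refine (MvPolynomial.comp_aeval_apply _ (Polynomial.aeval (z a)) f).trans ?_
      simp [eval_finsetSum]
    rw [this]
    exact MvPolynomial.dvd_aeval_sub_aeval (fun i => by
      convert he a i k using 1; simp) f
  have hall : ∀ k, C (s ^ k) ∣ G k := by
    refine pow_dvd_of_infinite_zeros hs hdiv hG ((hinf.image hz.injOn).mono ?_)
    rintro _ ⟨a, ha, rfl⟩ k
    have := hGe k a
    rw [ha] at this
    simpa using this
  by_contra hne
  obtain ⟨j, hj⟩ := hdiv _ hne
  -- The value is divisible by all powers of `s`, yet divides `s ^ j` if it is nonzero.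
  have h1 : s ^ (j + 1) ∣ s ^ j := by
    refine dvd_trans ?_ hj
    have h2 : s ^ (j + 1) ∣ (G (j + 1)).eval (z a) := by
      obtain ⟨H, hH⟩ := hall (j + 1)
      rw [hH, eval_mul, eval_C]
      exact dvd_mul_right _ _
    exact (dvd_iff_dvd_of_dvd_sub (hGe (j + 1) a)).mpr h2
  rw [pow_succ] at h1
  exact hu (isUnit_of_dvd_one ((mul_dvd_mul_iff_left (pow_ne_zero j hs)).mp (by simpa using h1)))

/-! ### A place of the algebraic closure -/

section
variable {A O : Type*} [CommRing A] [IsDomain A] [IsPrincipalIdealRing A] [CommRing O]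
  [IsDomain O] [Algebra A O] {s : A}

omit [IsDomain O] in
/-- A local `A`-algebra in which the prime `s` is not a unit is an algebra over the localization
of `A` at `(s)`. -/
theorem isUnit_algebraMap_of_not_dvd [IsLocalRing O] (hs : Prime s)
    (hsO : ¬ IsUnit (algebraMap A O s)) {a : A} (ha : ¬ s ∣ a) : IsUnit (algebraMap A O a) := by
  obtain ⟨u, v, huv⟩ := (hs.irreducible.coprime_iff_not_dvd).mpr ha
  have h := congrArg (algebraMap A O) huv
  rw [map_add, map_mul, map_mul, map_one] at h
  rcases IsLocalRing.isUnit_or_isUnit_of_add_one h with h1 | h1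
  · exact absurd (isUnit_of_mul_isUnit_right h1) hsO
  · exact isUnit_of_mul_isUnit_right h1

/-- A nonzero element of `O` divides a nonzero element of `A`, which is a power of `s` up to a unit
of `O`. -/
theorem exists_dvd_algebraMap_pow [IsLocalRing O] [Algebra.IsAlgebraic A O] (hs : Prime s)
    (hsO : ¬ IsUnit (algebraMap A O s)) {d : O} (hd : d ≠ 0) : ∃ j, d ∣ algebraMap A O s ^ j := by
  obtain ⟨r, hr, hdr⟩ := (Algebra.IsAlgebraic.isAlgebraic (R := A) d).exists_nonzero_dvd
    (mem_nonZeroDivisors_of_ne_zero hd)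
  obtain ⟨j, u, hu, rfl⟩ := WfDvdMonoid.max_power_factor hr hs.irreducible
  refine ⟨j, ?_⟩
  rw [map_mul, map_pow] at hdr
  exact (isUnit_algebraMap_of_not_dvd hs hsO hu).dvd_mul_right.mp hdr

/-- The valuation of `O` has no nonunits that are infinitesimal relative to `s`. -/
theorem exists_algebraMap_dvd_pow [ValuationRing O] [FaithfulSMul A O] [Algebra.IsAlgebraic A O]
    (hs : Prime s) (hsO : ¬ IsUnit (algebraMap A O s)) {y : O} (hy : ¬ IsUnit y) :
    ∃ k, algebraMap A O s ∣ y ^ k := by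
  classical
  rcases eq_or_ne y 0 with rfl | hy0
  · exact ⟨1, by simp⟩
  by_contra! hnot
  have hpow (k : ℕ) : y ^ k ∣ algebraMap A O s :=
    (ValuationRing.dvd_total _ _).resolve_right (hnot k)
  obtain ⟨p₀, hp₀, hpy₀⟩ := Algebra.IsAlgebraic.isAlgebraic (R := A) y
  obtain ⟨_⟩ := (nonempty_normalizedGCDMonoid_iff_isGCDMonoid (α := A)).mpr inferInstance
  set p := p₀.primPart
  have hpy : aeval y p = 0 := aeval_primPart_eq_zero hp₀ hpy₀
  have hex : ∃ i, ¬ s ∣ p.coeff i := by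
    by_contra! h
    exact hs.not_isUnit (p₀.isPrimitive_primPart s ((C_dvd_iff_dvd_coeff s p).mpr h))
  -- In `∑ p_j y ^ j = 0` let `i` be least with `s ∤ p_i`. As every power of `y` divides `s`, every
  -- other term is divisible by `y ^ (i + 1)`, whereas `p_i` is a unit.
  set i := Nat.find hex
  have hi : ¬ s ∣ p.coeff i := Nat.find_spec hex
  have hlt : i < p.natDegree + 1 :=
    Nat.lt_succ_of_le (le_natDegree_of_ne_zero fun h => hi (h ▸ dvd_zero s))
  have hdvd : y ^ (i + 1) ∣ algebraMap A O (p.coeff i) * y ^ i := by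
    rw [aeval_eq_sum_range, ← Finset.add_sum_erase _ _ (Finset.mem_range.mpr hlt)] at hpy
    rw [← Algebra.smul_def, eq_neg_of_add_eq_zero_left hpy, dvd_neg]
    refine Finset.dvd_sum fun j hj => ?_
    rw [Algebra.smul_def]
    rcases lt_or_gt_of_ne (Finset.ne_of_mem_erase hj) with h | h
    · exact (((hpow _).trans (map_dvd _ (not_not.mp (Nat.find_min hex h))))).mul_right _
    · exact (pow_dvd_pow y h).mul_left _
  rw [pow_succ', mul_dvd_mul_iff_right (pow_ne_zero i hy0)] at hdvd
  exact hy (isUnit_of_dvd_unit hdvd (isUnit_algebraMap_of_not_dvd hs hsO hi))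
end

/-- A finitely generated `F[t]`-subalgebra of an algebraic extension `L` of `F(t)` is contained in a
valuation ring of `L` whose topology is `s`-adic for some `s ∈ F[t]`, and its image modulo every
power of `s` is finite. -/
theorem exists_valuationSubring_adjoin {F L : Type*} [Field F] [Finite F] [Field L] [Algebra F[X] L]
    [FaithfulSMul F[X] L] [Algebra.IsAlgebraic F[X] L] {T : Set L} (hT : T.Finite) :
    ∃ (O : ValuationSubring L) (h : (Algebra.adjoin F[X] T).toSubring ≤ O.toSubring) (s : F[X]),
      let σ : O := Subring.inclusion h (algebraMap F[X] (Algebra.adjoin F[X] T) s)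
      σ ≠ 0 ∧ ¬ IsUnit σ ∧ (∀ d : O, d ≠ 0 → ∃ j, d ∣ σ ^ j) ∧
      ∀ n, Finite (Algebra.adjoin F[X] T ⧸
        (Ideal.span {σ ^ n}).comap (Subring.inclusion h)) := by
  classical
  set R := Algebra.adjoin F[X] T
  have : Algebra.FiniteType F[X] R := (Subalgebra.fg_iff_finiteType _).mp ⟨hT.toFinset, by simp [R]⟩
  let : Algebra F R := ((algebraMap F[X] R).comp (algebraMap F F[X])).toAlgebra
  have : IsScalarTower F F[X] R := IsScalarTower.of_algebraMap_eq fun _ => rfl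
  have : Algebra.FiniteType F R := Algebra.FiniteType.trans (S := F[X]) inferInstance inferInstance
  have : IsNoetherianRing R := Algebra.FiniteType.isNoetherianRing F R
  obtain ⟨M, hM⟩ := Ideal.exists_maximal R
  let := Ideal.Quotient.field M
  -- Zariski's lemma: the field `R ⧸ M` is of finite type over `F`.
  have : Module.Finite F (R ⧸ M) := finite_of_finite_type_of_isJacobsonRing F (R ⧸ M)
  have hfin : Finite (R ⧸ M) := Module.finite_of_finite F
  let P : Ideal F[X] := M.comap (algebraMap F[X] R)
  have hP : P.IsPrime := Ideal.comap_isPrime _ _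
  have hP0 : P ≠ ⊥ := by
    intro h0
    refine not_injective_infinite_finite ((Ideal.Quotient.mk M).comp (algebraMap F[X] R))
      ((injective_iff_map_eq_zero _).mpr fun a ha => ?_)
    have : algebraMap F[X] R a ∈ M := Ideal.Quotient.eq_zero_iff_mem.mp ha
    change a ∈ P at this
    rwa [h0] at this
  set s := Submodule.IsPrincipal.generator P
  have hs : Prime s := Submodule.IsPrincipal.prime_generator_of_isPrime P hP0
  have hsM : algebraMap F[X] R s ∈ M := Submodule.IsPrincipal.generator_mem P
  obtain ⟨O, hRO, hMO⟩ := Ideal.image_subset_nonunits_valuationSubring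
    (A := R.toSubring) (I := M) hM.ne_top
  let : Algebra F[X] O := ((Subring.inclusion hRO).comp (algebraMap F[X] R)).toAlgebra
  have : IsScalarTower F[X] O L := IsScalarTower.of_algebraMap_eq fun _ => rfl
  have : Algebra.IsAlgebraic F[X] O := Algebra.IsAlgebraic.of_injective
    (IsScalarTower.toAlgHom F[X] O L) Subtype.val_injective
  have : FaithfulSMul F[X] O := (faithfulSMul_iff_algebraMap_injective _ _).mpr fun a b hab =>
    FaithfulSMul.algebraMap_injective F[X] L (congrArg Subtype.val hab)
  have hnon (m : R) (hm : m ∈ M) : ¬ IsUnit (Subring.inclusion hRO m : O) :=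
    ValuationSubring.coe_mem_nonunits_iff.mp (hMO ⟨m, hm, rfl⟩)
  have hsO : ¬ IsUnit (algebraMap F[X] O s) := hnon _ hsM
  refine ⟨O, hRO, s, ?_, hsO, fun d hd => exists_dvd_algebraMap_pow hs hsO hd, fun n => ?_⟩
  · intro h0
    have h1 : algebraMap F[X] L s = 0 := congrArg Subtype.val h0
    exact hs.ne_zero ((map_eq_zero_iff _ (FaithfulSMul.algebraMap_injective _ _)).mp h1)
  · set J := (Ideal.span {algebraMap F[X] O s ^ n}).comap (Subring.inclusion hRO)
    have hMJ : M ≤ J.radical := by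
      intro m hm
      obtain ⟨k, hk⟩ := exists_algebraMap_dvd_pow hs hsO (hnon m hm)
      refine ⟨k * n, ?_⟩
      rw [Ideal.mem_comap, map_pow, Ideal.mem_span_singleton, pow_mul]
      exact pow_dvd_pow_of_dvd hk n
    obtain ⟨k, hk⟩ := Ideal.exists_pow_le_of_le_radical_of_fg hMJ (IsNoetherian.noetherian M)
    have := Ideal.finite_quotient_pow (IsNoetherian.noetherian M) k
    exact Finite.of_surjective _ (Ideal.Quotient.factor_surjective hk)

/-! ### The action as a convergent series -/

/-- Clearing the denominators of a polynomial, expressed through its values. -/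
theorem MvPolynomial.exists_integer_multiple_eval {O L σ : Type*} [CommRing O] [IsDomain O]
    [Field L] [Algebra O L] [IsFractionRing O L] (f : MvPolynomial σ L) :
    ∃ d : O, d ≠ 0 ∧ ∃ f' : MvPolynomial σ O, ∀ p : σ → O,
      algebraMap O L (eval p f') = algebraMap O L d * eval (fun i => algebraMap O L (p i)) f := by
  induction f using MvPolynomial.induction_on with
  | C a =>
    obtain ⟨u, d, hd, rfl⟩ := IsFractionRing.div_surjective (A := O) a
    have hd0 := nonZeroDivisors.ne_zero hd
    refine ⟨d, hd0, C u, fun p => ?_⟩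
    rw [eval_C, eval_C, mul_div_cancel₀]
    simpa using hd0
  | add f h hf hh =>
    obtain ⟨d, hd, f', hf'⟩ := hf
    obtain ⟨d', hd', h', hh'⟩ := hh
    refine ⟨d * d', mul_ne_zero hd hd', C d' * f' + C d * h', fun p => ?_⟩
    simp only [map_add, map_mul, eval_C, hf', hh']
    ring
  | mul_X f i hf =>
    obtain ⟨d, hd, f', hf'⟩ := hf
    refine ⟨d, hd, f' * X i, fun p => ?_⟩
    simp only [map_mul, eval_X, hf']
    ring

theorem Polynomial.finite_range_mod {F : Type*} [Field F] [Finite F] {b : F[X]} (hb : b ≠ 0) :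
    (Set.range fun a : F[X] => a % b).Finite := by
  have : Finite (degreeLT F b.natDegree) := Finite.of_equiv _ (degreeLTEquiv F _).symm.toEquiv
  refine (Set.toFinite (degreeLT F b.natDegree : Set F[X])).subset ?_
  rintro _ ⟨a, rfl⟩
  rw [SetLike.mem_coe, mem_degreeLT, ← degree_eq_natDegree hb]
  exact EuclideanDomain.mod_lt a hb

namespace DrinfeldML

theorem TwistedPoly.finite_range_coeff {F K : Type*} [Field K] (f : TwistedPoly F K) :
    (Set.range f.coeff).Finite := by
  obtain ⟨N, hN⟩ := f.coeff_eq_zero_of_large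
  refine (((Finset.range N).finite_toSet.image f.coeff).union (Set.finite_singleton 0)).subset ?_
  rintro _ ⟨n, rfl⟩
  rcases lt_or_ge n N with h | h
  · exact Or.inl ⟨n, by simpa using h, rfl⟩
  · exact Or.inr (hN n h)

variable {F K L : Type*} [Field F] [Fintype F] [Field K] [Algebra F⟮X⟯ K] [Field L] [Algebra K L]

/-- A ring containing the coefficients of `φ_c` for constants `c` and of `φ_t` contains those of all
`φ_a`. -/
theorem DrinfeldModule.coeff_mem (φ : DrinfeldModule F K) (R : Subring L)
    (hC : ∀ c n, algebraMap K L ((φ.toRingHom (C c)).coeff n) ∈ R)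
    (hX : ∀ n, algebraMap K L ((φ.toRingHom X).coeff n) ∈ R) (a : F[X]) (n : ℕ) :
    algebraMap K L ((φ.toRingHom a).coeff n) ∈ R := by
  have hmul {f h : TwistedPoly F K} (hf : ∀ n, algebraMap K L (f.coeff n) ∈ R)
      (hh : ∀ n, algebraMap K L (h.coeff n) ∈ R) (n : ℕ) :
      algebraMap K L ((f * h).coeff n) ∈ R := by
    rw [TwistedPoly.coeff_mul, map_sum]
    refine sum_mem fun i _ => ?_
    rw [map_mul, map_pow]
    exact mul_mem (hf _) (pow_mem (hh _) _)
  induction a using Polynomial.induction_on generalizing n with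
  | C c => exact hC c n
  | add f h hf hh =>
    rw [map_add, TwistedPoly.coeff_add, map_add]
    exact add_mem (hf n) (hh n)
  | monomial m c ih =>
    rw [pow_succ, ← mul_assoc, map_mul]
    exact hmul ih hX n

omit [Field F] [Algebra F⟮X⟯ K] in
theorem TwistedPoly.eval_mem (f : TwistedPoly F K) (R : Subring L)
    (hf : ∀ n, algebraMap K L (f.coeff n) ∈ R) {x : L} (hx : x ∈ R) : f.eval x ∈ R := by
  obtain ⟨N, hN⟩ := f.coeff_eq_zero_of_large
  rw [f.eval_eq_sum_range hN]
  exact sum_mem fun n _ => mul_mem (hf n) (pow_mem hx _)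

/-- On points divisible by `σ ^ 2` the map `a ↦ φ_a(w)` is the limit of a `σ`-adically convergent
series of polynomials in `a`. The `n`-th polynomial has value `c_n w ^ (q ^ n)` at `a`, where `c_n`
is the coefficient of `τ ^ n` in `φ_a`: the factor `σ ^ (2 q ^ n)` of `w ^ (q ^ n)` outweighs the
denominator `σ ^ (q ^ n - 1)`. -/
theorem DrinfeldModule.exists_expansion (φ : DrinfeldModule F K) (O : ValuationSubring L)
    (hO : ∀ a n, algebraMap K L ((φ.toRingHom a).coeff n) ∈ O) {s : F[X]} {σ : O}
    (hσ : (σ : L) = algebraMap K L (algebraMap F⟮X⟯ K (algebraMap F[X] F⟮X⟯ s)))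
    (hu : ¬ IsUnit σ) {w : O} (hw : σ ^ 2 ∣ w) :
    ∃ S : ℕ → O[X], (∀ n, C (σ ^ n) ∣ S n) ∧ ∀ (a : F[X]) (z e : O),
      (z : L) = algebraMap K L (algebraMap F⟮X⟯ K (algebraMap F[X] F⟮X⟯ a)) →
      (e : L) = (φ.toRingHom a).eval (w : L) →
      ∀ k, σ ^ k ∣ e - ∑ n ∈ Finset.range k, (S n).eval z := by
  set q := Fintype.card F
  have hq : 2 ≤ q := Fintype.one_lt_card
  let α (a : F[X]) (n : ℕ) : O := ⟨_, hO a n⟩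
  have hα (a : F[X]) (n : ℕ) : (α a n : L) = algebraMap K L ((φ.toRingHom a).coeff n) := rfl
  have hs0 : α s 0 = σ := Subtype.ext (by rw [hσ, hα, φ.coeff_zero])
  have hmul (a b : F[X]) (m : ℕ) :
      ∑ i ∈ Finset.range (m + 1), α a i * α b (m - i) ^ q ^ i = α (a * b) m := by
    apply Subtype.ext
    rw [hα, map_mul, TwistedPoly.coeff_mul]
    simp [α, q]
  have hunit (m : ℕ) (hm : m ≠ 0) : IsUnit (1 - α s 0 ^ m) :=
    IsLocalRing.isUnit_one_sub_self_of_mem_nonunits _ (by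
      rw [hs0, mem_nonunits_iff, isUnit_pow_iff hm]; exact hu)
  choose P hP using exists_eval_eq_pow_mul_coeff hq (α s) hunit
  obtain ⟨v, rfl⟩ := hw
  let S (n : ℕ) : O[X] := C (σ ^ (q ^ n + 1) * v ^ q ^ n) * P n
  have hS (n : ℕ) : C (σ ^ n) ∣ S n := by
    refine (_root_.map_dvd C ?_).mul_right _
    exact (pow_dvd_pow σ ((Nat.lt_pow_self hq).le.trans (Nat.le_succ _))).mul_right _
  refine ⟨S, hS, fun a z e hz he k => ?_⟩
  have hz' : z = α a 0 := Subtype.ext (by rw [hz, hα, φ.coeff_zero])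
  have hSe (n : ℕ) : (S n).eval z = α a n * (σ ^ 2 * v) ^ q ^ n := by
    have h1 := hP n (α a) fun m => by rw [hmul, hmul, mul_comm]
    rw [hz', eval_mul, eval_C, ← h1, hs0, mul_pow, ← pow_mul]
    have : σ ^ (2 * q ^ n) = σ ^ (q ^ n + 1) * σ ^ (q ^ n - 1) := by
      have : 0 < q ^ n := pow_pos (by omega) n
      rw [← pow_add]; congr 1; omega
    rw [this]; ring
  obtain ⟨N, hN⟩ := (φ.toRingHom a).coeff_eq_zero_of_large
  have he' : e = ∑ n ∈ Finset.range (k + N), (S n).eval z := by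
    apply Subtype.ext
    rw [he, TwistedPoly.eval_eq_sum_range _ (N := k + N) fun n hn => hN n (by omega)]
    simp [hSe, α, q]
  rw [he', Finset.sum_range_add, add_sub_cancel_left]
  refine Finset.dvd_sum fun n _ => ?_
  obtain ⟨H, hH⟩ := hS (k + n)
  rw [hH, eval_mul, eval_C, pow_add]
  exact ((dvd_mul_right _ _).mul_right _)

variable {g : ℕ} (φ : Fin g → DrinfeldModule F K)

/-- The additive map `a ↦ φ_a(x)` from `F[t]` to `L ^ g`; its range is the cyclic `φ`-submodule
generated by `x`. -/
noncomputable def actHom (x : Fin g → L) : F[X] →+ (Fin g → L) :=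
  AddMonoidHom.mk' (fun a => act φ a x) fun a b => by
    funext i
    simp only [act, map_add, TwistedPoly.eval_add, Pi.add_apply]

theorem actHom_apply (x : Fin g → L) (a : F[X]) : actHom φ x a = act φ a x := rfl

theorem actHom_mul (x : Fin g → L) (a b : F[X]) :
    actHom φ x (a * b) = actHom φ (actHom φ x b) a := by
  funext i
  simp only [actHom_apply, act, map_mul, TwistedPoly.eval_mul]

theorem isSubmodule_range_actHom (x : Fin g → L) : IsSubmodule φ (actHom φ x).range := by
  rintro a _ ⟨b, rfl⟩
  exact ⟨a * b, actHom_mul φ x a b⟩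

theorem actHom_eq_mod_add (x : Fin g → L) (a b : F[X]) :
    actHom φ x a = actHom φ x (a % b) + actHom φ (actHom φ x b) (a / b) := by
  rw [← actHom_mul, ← map_add, mul_comm, EuclideanDomain.mod_add_div]

/-- An infinite cyclic `φ`-submodule is free: if `φ_b(x) = 0` with `b ≠ 0`, then `φ_a(x)` depends
only on the remainder of `a` modulo `b`. -/
theorem actHom_injective {x : Fin g → L} (hx : (Set.range (actHom φ x)).Infinite) :
    Function.Injective (actHom φ x) := by
  refine (injective_iff_map_eq_zero _).mpr fun b hb => ?_
  by_contra hb0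
  refine hx (((Polynomial.finite_range_mod hb0).image (actHom φ x)).subset ?_)
  rintro _ ⟨a, rfl⟩
  refine ⟨a % b, ⟨a, rfl⟩, ?_⟩
  rw [actHom_eq_mod_add φ x a b, hb]
  have : actHom φ (0 : Fin g → L) (a / b) = 0 := by
    have := actHom_mul φ (0 : Fin g → L) (a / b) 0
    rw [mul_zero, map_zero] at this
    exact this.symm
  rw [this, add_zero]

end DrinfeldML

/-! ### The choice of the place and the theorem -/

namespace DrinfeldML

/-- A place of `L` where the `φ_i` and `x` are integral, and a multiple `φ_b(x)` with `b ≠ 0` that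
is close to the origin at this place. -/
theorem exists_ne_zero_actHom_dvd {F K L : Type*} [Field F] [Fintype F] [Field K]
    [Algebra F⟮X⟯ K] [FiniteDimensional F⟮X⟯ K] [Field L] [Algebra K L] [Algebra.IsAlgebraic K L]
    {g : ℕ} (φ : Fin g → DrinfeldModule F K) (x : Fin g → L) :
    ∃ (O : ValuationSubring L) (s : F[X]) (σ : O),
      (σ : L) = algebraMap K L (algebraMap F⟮X⟯ K (algebraMap F[X] F⟮X⟯ s)) ∧
      σ ≠ 0 ∧ ¬ IsUnit σ ∧ (∀ d : O, d ≠ 0 → ∃ j, d ∣ σ ^ j) ∧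
      (∀ a, algebraMap K L (algebraMap F⟮X⟯ K (algebraMap F[X] F⟮X⟯ a)) ∈ O) ∧
      (∀ i a n, algebraMap K L (((φ i).toRingHom a).coeff n) ∈ O) ∧ (∀ i, x i ∈ O) ∧
      ∃ b : F[X], b ≠ 0 ∧ ∀ i, ∃ w : O, σ ^ 2 ∣ w ∧ (w : L) = actHom φ x b i := by
  let : Algebra F⟮X⟯ L := ((algebraMap K L).comp (algebraMap F⟮X⟯ K)).toAlgebra
  have : IsScalarTower F⟮X⟯ K L := IsScalarTower.of_algebraMap_eq fun _ => rfl
  let : Algebra F[X] L := ((algebraMap F⟮X⟯ L).comp (algebraMap F[X] F⟮X⟯)).toAlgebra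
  have : IsScalarTower F[X] F⟮X⟯ L := IsScalarTower.of_algebraMap_eq fun _ => rfl
  have : Algebra.IsAlgebraic F⟮X⟯ L := Algebra.IsAlgebraic.trans F⟮X⟯ K L
  have : Algebra.IsAlgebraic F[X] L := (IsFractionRing.comap_isAlgebraic_iff (K := F⟮X⟯)).mpr this
  have : FaithfulSMul F[X] L := (faithfulSMul_iff_algebraMap_injective _ _).mpr
    ((algebraMap F⟮X⟯ L).injective.comp (IsFractionRing.injective F[X] F⟮X⟯))
  let T : Set L := Set.range x ∪
    ((⋃ i, ⋃ c : F, algebraMap K L '' Set.range ((φ i).toRingHom (C c)).coeff) ∪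
      ⋃ i, algebraMap K L '' Set.range ((φ i).toRingHom X).coeff)
  have hT : T.Finite := (Set.finite_range x).union
    ((Set.finite_iUnion fun i => Set.finite_iUnion fun c =>
      (TwistedPoly.finite_range_coeff _).image _).union
      (Set.finite_iUnion fun i => (TwistedPoly.finite_range_coeff _).image _))
  obtain ⟨O, hRO, s, hσ0, hσu, hdiv, hfin⟩ := exists_valuationSubring_adjoin (F := F) hT
  set R := Algebra.adjoin F[X] T
  have hTR : T ⊆ R := Algebra.subset_adjoin
  have hxR (i : Fin g) : x i ∈ R := hTR (Or.inl ⟨i, rfl⟩)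
  have hcoeff (i : Fin g) (a : F[X]) (n : ℕ) :
      algebraMap K L (((φ i).toRingHom a).coeff n) ∈ R.toSubring :=
    (φ i).coeff_mem R.toSubring
      (fun c n => hTR (Or.inr (Or.inl (Set.mem_iUnion₂.mpr ⟨i, c, _, ⟨n, rfl⟩, rfl⟩))))
      (fun n => hTR (Or.inr (Or.inr (Set.mem_iUnion.mpr ⟨i, _, ⟨n, rfl⟩, rfl⟩)))) a n
  refine ⟨O, s, _, rfl, hσ0, hσu, hdiv, fun a => hRO (R.algebraMap_mem a),
    fun i a n => hRO (hcoeff i a n), fun i => hRO (hxR i), ?_⟩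
  have hact (a : F[X]) (i : Fin g) : actHom φ x a i ∈ R.toSubring :=
    TwistedPoly.eval_mem _ _ (hcoeff i a) (hxR i)
  have := hfin 2
  -- Two elements of the infinite ring `F[t]` have congruent images in the finite quotient.
  obtain ⟨a, b, hab, hne⟩ := Function.not_injective_iff.mp (not_injective_infinite_finite
    fun (a : F[X]) (i : Fin g) => Ideal.Quotient.mk ((Ideal.span
      {(Subring.inclusion hRO (algebraMap F[X] R s) : O) ^ 2}).comap (Subring.inclusion hRO))
        (⟨actHom φ x a i, hact a i⟩ : R))
  refine ⟨a - b, sub_ne_zero.mpr hne, fun i => ⟨⟨actHom φ x (a - b) i, hRO (hact _ i)⟩, ?_, rfl⟩⟩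
  have h := Ideal.Quotient.eq.mp (congrFun hab i)
  rw [Ideal.mem_comap, Ideal.mem_span_singleton] at h
  have e : (⟨actHom φ x (a - b) i, hRO (hact _ i)⟩ : O) =
      Subring.inclusion hRO (⟨actHom φ x a i, hact a i⟩ - ⟨actHom φ x b i, hact b i⟩ : R) :=
    Subtype.ext (congrFun (map_sub (actHom φ x) a b) i)
  rw [e]
  exact h

end DrinfeldML

theorem theorem3p5 {F K L : Type*} [Field F] [Fintype F] [Field K] [Algebra F⟮X⟯ K]
    [FiniteDimensional F⟮X⟯ K] [Field L] [Algebra K L] [IsAlgClosure K L] {g : ℕ}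
    (φ : Fin g → DrinfeldML.DrinfeldModule F K) (Γ : AddSubgroup (Fin g → L))
    (hΓ : DrinfeldML.IsSubmodule φ Γ) (hcyc : DrinfeldML.IsCyclic φ Γ)
    (hinf : (Γ : Set (Fin g → L)).Infinite) :
    ∃ Γ₀ : AddSubgroup (Fin g → L), DrinfeldML.IsSubmodule φ Γ₀ ∧ Γ₀ ≤ Γ ∧
      (Γ₀ : Set (Fin g → L)).Infinite ∧
      ∀ I : Ideal (MvPolynomial (Fin g) L),
        (MvPolynomial.zeroLocus L I ∩ (Γ : Set (Fin g → L))).Infinite →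
        ∃ y : Fin g → L, y +ᵥ (Γ₀ : Set (Fin g → L)) ⊆
          MvPolynomial.zeroLocus L I ∩ (Γ : Set (Fin g → L)) := by
  open DrinfeldML in
  obtain ⟨x, hx⟩ := hcyc
  replace hx : (Γ : Set (Fin g → L)) = Set.range (actHom φ x) := hx
  have hinj : Function.Injective (actHom φ x) := actHom_injective φ (hx ▸ hinf)
  have hΓx (a : F[X]) : actHom φ x a ∈ Γ := by
    rw [← SetLike.mem_coe, hx]
    exact ⟨a, rfl⟩
  have : Algebra.IsAlgebraic K L := IsAlgClosure.isAlgebraic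
  obtain ⟨O, s, σ, hσ, hσ0, hσu, hdiv, hFO, hcoeff, hxO, b, hb, hw⟩ := exists_ne_zero_actHom_dvd φ x
  choose w hw2 hwb using hw
  choose S hS hexp using fun i => (φ i).exists_expansion O (hcoeff i) hσ hσu (hw2 i)
  have hactO {p : Fin g → L} (hp : ∀ i, p i ∈ O) (a : F[X]) (i : Fin g) : actHom φ p a i ∈ O :=
    TwistedPoly.eval_mem _ O.toSubring (hcoeff i a) (hp i)
  let z (a : F[X]) : O := ⟨_, hFO a⟩
  have hz : Function.Injective z := fun a a' h => IsFractionRing.injective F[X] F⟮X⟯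
    ((algebraMap F⟮X⟯ K).injective ((algebraMap K L).injective (congrArg Subtype.val h)))
  have hwb' : (fun i => (w i : L)) = actHom φ x b := funext hwb
  let e (a : F[X]) (i : Fin g) : O := ⟨_, hactO (fun i => (w i).2) a i⟩
  have he (a : F[X]) : (fun i => (e a i : L)) = actHom φ (actHom φ x b) a := by
    rw [← hwb']
  refine ⟨(actHom φ (actHom φ x b)).range, isSubmodule_range_actHom φ _, ?_, ?_, fun I hI => ?_⟩
  · rintro _ ⟨a, rfl⟩
    exact hΓ a _ (hΓx b)
  · refine Set.infinite_range_of_injective fun a a' h => ?_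
    rw [← actHom_mul, ← actHom_mul] at h
    exact mul_right_cancel₀ hb (hinj h)
  -- `Γ` is the union of the finitely many cosets of `Γ₀` given by the remainders `r` modulo `b`.
  obtain ⟨r, hr⟩ : ∃ r, {a | actHom φ x r + actHom φ (actHom φ x b) a ∈
      MvPolynomial.zeroLocus L I}.Infinite := by
    by_contra! hfin
    refine hI (((Polynomial.finite_range_mod hb).biUnion fun r _ => (hfin r).image
      fun a => actHom φ x r + actHom φ (actHom φ x b) a).subset ?_)
    rintro p ⟨hpI, hpΓ⟩
    rw [hx] at hpΓ
    obtain ⟨a, rfl⟩ := hpΓ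
    rw [actHom_eq_mod_add φ x a b] at hpI ⊢
    exact Set.mem_biUnion ⟨a, rfl⟩ ⟨a / b, hpI, rfl⟩
  refine ⟨actHom φ x r, ?_⟩
  rintro _ ⟨_, ⟨a, rfl⟩, rfl⟩
  refine ⟨fun f hf => ?_, Γ.add_mem (hΓx r) (hΓ a _ (hΓx b))⟩
  obtain ⟨d, hd, f', hf'⟩ := MvPolynomial.exists_integer_multiple_eval (O := O) f
  let y (i : Fin g) : O := ⟨_, hactO hxO r i⟩
  have hiff (c : F[X]) : MvPolynomial.eval (y + e c) f' = 0 ↔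
      MvPolynomial.aeval (actHom φ x r + actHom φ (actHom φ x b) c) f = 0 := by
    rw [← (FaithfulSMul.algebraMap_injective O L).eq_iff, hf', map_zero, mul_eq_zero,
      or_iff_right (by simpa using hd), ← he c]
    rfl
  refine (hiff a).mp (eval_add_eq_zero_of_infinite hσ0 hσu hdiv hz hS
    (fun c i k => hexp i c (z c) (e c i) rfl rfl k) y f' (hr.mono fun c hc => ?_) a)
  exact (hiff c).mpr (hc f hf)
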